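/- A permutation of size $n\ge 1$ is a bijection $\pi:[n]\to[n]$, also written as the word $\pi(1)\pi(2)\cdots\pi(n)$; it is non-trivial if $n\ge 2$. The direct sum $\pi_1\oplus\pi_2$ is the permutation of size $|\pi_1|+|\pi_2|$ that maps $i\mapsto\pi_1(i)$ for $i\le|\pi_1|$ and $|\pi_1|+i\mapsto|\pi_1|+\pi_2(i)$ for $i\in[|\pi_2|]$. A permutation is indecomposable if it is not a direct sum of two permutations; every permutation $\pi$ is, in a unique way, a direct sum of indecomposable permutations, and $\overline{\pi}$ denotes the word formed by these indecomposable blocks in order. The indecomposable permutations are the letters of an alphabet, linearly ordered by size and, within each size, lexicographically. A non-empty word is a Lyndon word if none of its non-empty proper suffixes is lexicographically smaller than the word itself (a proper prefix of a word being smaller than the word). A permutation $\pi$ is Lyndon if $\overline{\pi}$ is a Lyndon word. Let $\mathcal P^L_k$ be the set of all non-trivial Lyndon permutations of size at most $k$. A permuton is a Borel probability measure $\Pi$ on $[0,1]^2$ both of whose marginals are the uniform measure on $[0,1]$. The density $d(\sigma,\Pi)$ of a permutation $\sigma$ of size $n$ in $\Pi$ is the probability that $n$ independent points sampled according to $\Pi$,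 listed as $(x_1,y_1),\ldots,(x_n,y_n)$ with $x_1<\cdots<x_n$, satisfy $y_i<y_j\iff\sigma(i)<\sigma(j)$ for all $i,j\in[n]$. **Theorem.** For every integer $k\ge 2$ there exist $x_0\in[0,1]^{\mathcal P^L_k}$ and $\varepsilon>0$ such that the open Euclidean ball $B_\varepsilon(x_0)\subset\mathbb R^{\mathcal P^L_k}$ is contained in $[0,1]^{\mathcal P^L_k}$ and for every $x\in B_\varepsilon(x_0)$ there exists a permuton $\Pi$ with $d(\sigma,\Pi)=x_\sigma$ for all $\sigma\in\mathcal P^L_k$. -/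

import Mathlib

open MeasureTheory

/-- A permutation of arbitrary finite size: a size `n` together with a bijection of
`Fin n = {0, …, n - 1}`. -/
abbrev Permutation : Type := Σ n : ℕ, Equiv.Perm (Fin n)

namespace Permutation

/-- The size of a permutation. -/
def size (a : Permutation) : ℕ := a.1

/-- The one-line word `π(0) π(1) … π(n - 1)`. -/
def oneLine (a : Permutation) : List ℕ := List.ofFn (fun i : Fin a.1 => (a.2 i : ℕ))

/-- The direct sum `a ⊕ b`: the permutation acting as `a` on the first `|a|` elements, and as
`b`, shifted by `|a|`, on the remaining `|b|` elements. -/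
def directSum (a b : Permutation) : Permutation :=
  ⟨a.1 + b.1, finSumFinEquiv.permCongr (Equiv.Perm.sumCongr a.2 b.2)⟩

/-- The direct sum of a word of permutations (the empty permutation for the empty word). -/
def directSumList (w : List Permutation) : Permutation :=
  w.foldr directSum ⟨0, Equiv.refl (Fin 0)⟩

/-- A permutation (of positive size) is indecomposable if it is not the direct sum of two
permutations of positive size. -/
def Indecomposable (a : Permutation) : Prop :=
  1 ≤ a.size ∧ ∀ b c : Permutation, 1 ≤ b.size → 1 ≤ c.size → a ≠ directSum b c

/-- The order of the alphabet of indecomposable permutations: smaller sizes come first, and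
permutations of equal size are ordered lexicographically by their one-line words. -/
def LetterLT (a b : Permutation) : Prop :=
  a.size < b.size ∨
    (a.size = b.size ∧ List.Lex (fun i j : ℕ => i < j) a.oneLine b.oneLine)

/-- `w` is the word formed by the indecomposable blocks of `a`. -/
def IsBlockWord (w : List Permutation) (a : Permutation) : Prop :=
  (∀ b ∈ w, Indecomposable b) ∧ directSumList w = a

end Permutation

/-- A non-empty word is a Lyndon word, with respect to the order `r` of the letters, if none of
its non-empty proper suffixes is lexicographically smaller than the word itself. -/
def IsLyndonWord {α : Type*} (r : α → α → Prop) (w : List α) : Prop :=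
  w ≠ [] ∧ ∀ u v : List α, u ≠ [] → v ≠ [] → w = u ++ v → ¬ List.Lex r v w

namespace Permutation

/-- A permutation is Lyndon if the word formed by its indecomposable blocks is a Lyndon word. -/
def IsLyndon (a : Permutation) : Prop :=
  ∃ w : List Permutation, IsBlockWord w a ∧ IsLyndonWord LetterLT w

open Classical in
/-- The finite set of all non-trivial Lyndon permutations of size at most `k`
(non-trivial means of size at least two). -/
noncomputable def lyndonPermutations (k : ℕ) : Finset Permutation :=
  ((Finset.Icc 2 k).sigma (fun _ => Finset.univ)).filter IsLyndon

end Permutation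

/-- A permuton: a Borel probability measure on `[0,1]²` both of whose marginals are the uniform
(Lebesgue) measure on `[0,1]`. -/
structure Permuton where
  /-- The underlying measure. -/
  measure : Measure (unitInterval × unitInterval)
  isProbabilityMeasure : IsProbabilityMeasure measure
  map_fst : measure.map Prod.fst = volume
  map_snd : measure.map Prod.snd = volume

namespace Permutation

/-- The points `p 0, …, p (n - 1)` induce the permutation `a` of size `n`: when they are listed as
`p (τ 0), …, p (τ (n - 1))` with strictly increasing first coordinates, the second coordinates
are in the same relative order as the values of `a`. -/
def InducedBy (a : Permutation) (p : Fin a.1 → unitInterval × unitInterval) : Prop :=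
  ∃ τ : Equiv.Perm (Fin a.1), StrictMono (fun i => (p (τ i)).1) ∧
    ∀ i j : Fin a.1, a.2 i < a.2 j ↔ (p (τ i)).2 < (p (τ j)).2

/-- The density `d(a, P)`: the probability that `|a|` independent points sampled according to
the permuton `P` induce the permutation `a`. -/
noncomputable def density (a : Permutation) (P : Permuton) : ℝ :=
  (Measure.pi (fun _ : Fin a.1 => P.measure)).real {p | a.InducedBy p}

end Permutation

/-!
The densities of the Lyndon permutations are realized independently by a blow-up construction.
Let `a i` be the given Lyndon permutations, with block words `w i`, and consider the direct sum of
all `a i`, arranged such that their block words decrease. Replace each point `v` of this direct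
sum by an increasing diagonal of mass `t v`; this yields a permuton (`Permutation.blowup`), in
which the density of any permutation is a polynomial of the masses
(`Permutation.density_blowup`). It suffices that the Jacobian of these polynomials does not vanish
at some point with positive coordinates: the density map is then open there
(`HasStrictFDerivAt.map_nhds_eq_of_surj`). To get rid of the constraint that the masses add up to
one, the permutation of size one, which is also Lyndon, is included among the `a i`: its
polynomial is the total mass.

Choose a point `p i` in each summand `a i`. In the determinant of the matrix of the polynomials
`X_{p j} ∂ P_i / ∂ X_{p j}`, the coefficient of the product of all variables is a signed sum over
the partitions of the points of the direct sum into occurrences of the `a i`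
(`exists_map_nhds_tupleSum_eq`). It is positive because the only such partition is the trivial one
(`Permutation.block_eq_of_isPatternMap`). Indeed, an occurrence maps each indecomposable block
into a single block (`Permutation.IsPatternMap.exists_block_map`), so counting shows that
the occurrences permute the blocks. Hence the partition exhibits the concatenation of the
decreasing Lyndon words `w i` as a shuffle of the same words, and there is only one such shuffle
(`colours_eq_of_colourSubword_eq`). The reason is that a Lyndon word which is a shuffle of two or
more non-empty words is smaller than one of them
(`IsLyndonWord.monochromatic_or_lt_colourSubword`); this follows by induction from the
factorization of a Lyndon word into two Lyndon words.
-/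

/-! ### Lyndon words and their shuffles -/

section Words

variable {α ι : Type*}

/-- The subword of a coloured word that is formed by the letters of colour `i`. -/
def colourSubword [DecidableEq ι] (i : ι) (L : List (α × ι)) : List α :=
  (L.filter (fun p => p.2 = i)).map Prod.fst

theorem colourSubword_append [DecidableEq ι] (i : ι) (L M : List (α × ι)) :
    colourSubword i (L ++ M) = colourSubword i L ++ colourSubword i M := by
  simp [colourSubword]

theorem colourSubword_eq_map [DecidableEq ι] {i : ι} {L : List (α × ι)}
    (h : ∀ p ∈ L, p.2 = i) : colourSubword i L = L.map Prod.fst := by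
  rw [colourSubword, List.filter_eq_self.2 (by simpa using h)]

theorem colourSubword_eq_nil [DecidableEq ι] {i j : ι} {L : List (α × ι)}
    (h : ∀ p ∈ L, p.2 = i) (hij : i ≠ j) : colourSubword j L = [] := by
  rw [colourSubword, List.filter_eq_nil_iff.2, List.map_nil]
  intro p hp
  simpa [h p hp] using hij

theorem length_colourSubword_le [DecidableEq ι] (i : ι) (L : List (α × ι)) :
    (colourSubword i L).length ≤ (L.map Prod.fst).length := by
  simpa [colourSubword] using List.length_filter_le _ L

variable [LinearOrder α]

theorem List.append_lt_append_of_lt_of_length_le {l p : List α} (h : l < p)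
    (hlen : p.length ≤ l.length) (a b : List α) : l ++ a < p ++ b := by
  induction l generalizing p with
  | nil =>
    have : p = [] := List.length_eq_zero_iff.1 (by simpa using hlen)
    simp [this] at h
  | cons x l ih =>
    cases p with
    | nil => simp at h
    | cons y p =>
      rw [List.cons_lt_cons_iff] at h
      rw [List.cons_append, List.cons_append, List.cons_lt_cons_iff]
      rcases h with h | ⟨h, h'⟩
      · exact Or.inl h
      · exact Or.inr ⟨h, ih h' (by simpa using hlen)⟩

theorem List.append_lt_append_iff_of_left_eq {u v w : List α} : u ++ v < u ++ w ↔ v < w := by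
  induction u with
  | nil => simp
  | cons x u ih => simp [ih]

theorem IsLyndonWord.lt_of_eq_append {w u v : List α} (h : IsLyndonWord (· < ·) w)
    (hu : u ≠ []) (hv : v ≠ []) (hw : w = u ++ v) : w < v := by
  have h1 : ¬ v < w := h.2 u v hu hv hw
  refine lt_of_le_of_ne (not_lt.1 h1) ?_
  intro h2
  have := congrArg List.length (h2.symm.trans hw)
  simp at this
  exact hu this

/-- The right factor is the smallest proper suffix. -/
theorem IsLyndonWord.exists_factorization {w : List α} (h : IsLyndonWord (· < ·) w)
    (hw : 2 ≤ w.length) :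
    ∃ u v, w = u ++ v ∧ IsLyndonWord (· < ·) u ∧ IsLyndonWord (· < ·) v := by
  classical
  let S : Set (List α) := {v | v ≠ [] ∧ ∃ u, u ≠ [] ∧ w = u ++ v}
  have hfin : S.Finite := by
    refine (List.finite_toSet w.tails).subset ?_
    rintro v ⟨-, u, -, huv⟩
    exact (List.mem_tails _ _).2 ⟨u, huv.symm⟩
  have hne : S.Nonempty := by
    obtain ⟨x, y, t, hxyt⟩ : ∃ x y t, w = x :: y :: t := by
      match w, hw with
      | x :: y :: t, _ => exact ⟨x, y, t, rfl⟩
    exact ⟨y :: t, by simp, [x], by simp, by simp [hxyt]⟩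
  obtain ⟨v, ⟨hv, u, hu, huv⟩, hmin⟩ := Set.exists_min_image S id hfin hne
  simp only [id] at hmin
  refine ⟨u, v, huv, ⟨hu, ?_⟩, hv, ?_⟩
  · intro x y hx hy hxy (hlt : y < u)
    by_cases hp : y <+: u
    · obtain ⟨z, hz⟩ := hp
      have hzne : z ≠ [] := by
        rintro rfl
        have := congrArg List.length (hz.trans hxy)
        simp at this
        exact hx this
      have h1 : w < y ++ v := h.lt_of_eq_append (u := x) hx (by simp [hy]) (by simp [huv, hxy])
      have h2 : z ++ v < v := by
        rw [huv, ← hz, List.append_assoc, List.append_lt_append_iff_of_left_eq] at h1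
        exact h1
      exact (hmin (z ++ v) ⟨by simp [hv], y, hy, by simp [huv, ← hz]⟩).not_gt h2
    · have h1 : w < y ++ v := h.lt_of_eq_append (u := x) hx (by simp [hy]) (by simp [huv, hxy])
      -- a smaller word that is not a prefix stays smaller after any extension
      have key : ∀ (y u : List α), y < u → ¬ y <+: u → y ++ v < u ++ v := by
        intro y
        induction y with
        | nil => intro u _ h; exact absurd (List.nil_prefix) h
        | cons a y ih =>
          intro u h h'
          cases u with
          | nil => simp at h
          | cons b u =>
            rw [List.cons_lt_cons_iff] at h
            rw [List.cons_append, List.cons_append, List.cons_lt_cons_iff]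
            rcases h with h | ⟨rfl, h⟩
            · exact Or.inl h
            · exact Or.inr ⟨rfl, ih u h (by simpa using h')⟩
      exact lt_asymm h1 (huv ▸ key y u hlt hp)
  · intro x y hx hy hxy (hlt : y < v)
    exact (hmin y ⟨hy, u ++ x, by simp [hu], by simp [huv, hxy]⟩).not_gt hlt

/-- If a Lyndon word is a shuffle of two or more non-empty words, then one of these is
lexicographically larger than the Lyndon word. -/
theorem IsLyndonWord.monochromatic_or_lt_colourSubword [DecidableEq ι] (L : List (α × ι))
    (hL : IsLyndonWord (· < ·) (L.map Prod.fst)) :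
    (∃ i, ∀ p ∈ L, p.2 = i) ∨ ∃ i, L.map Prod.fst < colourSubword i L := by
  induction hn : L.length using Nat.strong_induction_on generalizing L with
  | _ n ih =>
  by_cases hlen : 2 ≤ (L.map Prod.fst).length
  · obtain ⟨u, v, huv, hu, hv⟩ := hL.exists_factorization hlen
    obtain ⟨L₁, L₂, rfl, rfl, rfl⟩ := List.map_eq_append_iff.1 huv
    have h1 : 0 < L₁.length := List.length_pos_iff.2 (by simpa using hu.1)
    have h2 : 0 < L₂.length := List.length_pos_iff.2 (by simpa using hv.1)
    rw [List.length_append] at hn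
    have hlt : (L₁ ++ L₂).map Prod.fst < L₂.map Prod.fst :=
      hL.lt_of_eq_append hu.1 hv.1 huv
    simp only [colourSubword_append, huv] at hlt ⊢
    -- the only case without a colour class that is large in `L₁` or `L₂` is that of two
    -- monochromatic factors; if their colours differ, then one colour class is the right factor,
    -- which is larger than the whole word
    rcases ih _ (by omega) L₁ hu rfl with ⟨i, hi⟩ | ⟨i, hi⟩
    · rcases ih _ (by omega) L₂ hv rfl with ⟨j, hj⟩ | ⟨j, hj⟩
      · by_cases hij : i = j
        · subst hij
          refine Or.inl ⟨i, fun p hp => ?_⟩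
          rcases List.mem_append.1 hp with hp | hp
          exacts [hi p hp, hj p hp]
        · refine Or.inr ⟨j, ?_⟩
          rwa [colourSubword_eq_nil hi hij, colourSubword_eq_map hj, List.nil_append]
      · refine Or.inr ⟨j, ?_⟩
        by_cases hij : i = j
        · subst hij
          rwa [colourSubword_eq_map hi, List.append_lt_append_iff_of_left_eq]
        · rw [colourSubword_eq_nil hi hij, List.nil_append]
          exact hlt.trans hj
    · exact Or.inr ⟨i, List.append_lt_append_of_lt_of_length_le hi
        (length_colourSubword_le i L₁) _ _⟩
  · left
    match L, hL.1 with
    | [p], _ => exact ⟨p.2, by simp⟩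
    | _ :: _ :: _, _ => simp at hlen

/-- A concatenation of strictly decreasing Lyndon words is a shuffle of these words in one way
only: this is the multiplicity-free case of the statement that the concatenation is the
largest word in the shuffle product, with coefficient one. -/
theorem colours_eq_of_colourSubword_eq [DecidableEq ι] (w : ι → List α) (is : List ι)
    (hdec : is.Pairwise (fun i j => w j < w i)) (hw : ∀ i ∈ is, IsLyndonWord (· < ·) (w i))
    (L : List (α × ι)) (h1 : L.map Prod.fst = is.flatMap w)
    (h2 : ∀ i ∈ is, colourSubword i L = w i) (h3 : ∀ p ∈ L, p.2 ∈ is) :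
    L.map Prod.snd = is.flatMap (fun i => List.replicate (w i).length i) := by
  induction is generalizing L with
  | nil => simpa using h1
  | cons i is ih =>
    rw [List.flatMap_cons] at h1 ⊢
    obtain ⟨L₁, L₂, rfl, hi, hL₂⟩ := List.map_eq_append_iff.1 h1
    rw [List.pairwise_cons] at hdec
    have hmono : ∀ p ∈ L₁, p.2 = i := by
      have hle : ∀ j ∈ i :: is, w j ≤ w i := by
        intro j hj
        rcases List.mem_cons.1 hj with rfl | hj
        exacts [le_rfl, (hdec.1 j hj).le]
      have hnil : ∀ j, j ∉ i :: is → colourSubword j L₁ = [] := by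
        intro j hj
        rw [colourSubword, List.filter_eq_nil_iff.2, List.map_nil]
        intro p hp
        have := h3 p (List.mem_append_left _ hp)
        simp only [decide_eq_true_eq]
        rintro rfl
        exact hj this
      have hLy : IsLyndonWord (· < ·) (L₁.map Prod.fst) := hi ▸ hw i (by simp)
      rcases hLy.monochromatic_or_lt_colourSubword with ⟨j, hj⟩ | ⟨j, hj⟩
      · have hne : L₁ ≠ [] := by simpa using hLy.1
        obtain ⟨p, hp⟩ := List.exists_mem_of_ne_nil _ hne
        have hjm : j ∈ i :: is := hj p hp ▸ h3 p (List.mem_append_left _ hp)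
        rcases List.mem_cons.1 hjm with rfl | hjm'
        · exact hj
        · -- the first Lyndon word would be a prefix of a smaller one
          have h4 := h2 j hjm
          rw [colourSubword_append, colourSubword_eq_map hj, hi] at h4
          have h5 := hdec.1 j hjm'
          rw [← h4] at h5
          nth_rewrite 2 [← List.append_nil (w i)] at h5
          rw [List.append_lt_append_iff_of_left_eq] at h5
          simp at h5
      · -- a colour class that is larger than the largest Lyndon word extends to a larger one
        exfalso
        by_cases hjm : j ∈ i :: is
        · have h4 := List.append_lt_append_of_lt_of_length_le hj
            (length_colourSubword_le j L₁) [] (colourSubword j L₂)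
          rw [← colourSubword_append, h2 j hjm, List.append_nil, hi] at h4
          exact (hle j hjm).not_gt h4
        · rw [hnil j hjm] at hj
          simp at hj
    have hL₁ : L₁.map Prod.snd = List.replicate (w i).length i := by
      rw [List.eq_replicate_iff]
      refine ⟨by rw [← hi]; simp, ?_⟩
      intro j hj
      obtain ⟨p, hp, rfl⟩ := List.mem_map.1 hj
      exact hmono p hp
    have hL₂i : colourSubword i L₂ = [] := by
      have := h2 i (by simp)
      rw [colourSubword_append, colourSubword_eq_map hmono, hi] at this
      simpa using this
    have hni : ∀ j ∈ is, i ≠ j := by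
      rintro j hj rfl
      exact lt_irrefl _ (hdec.1 _ hj)
    rw [List.map_append, hL₁, ih hdec.2 (fun j hj => hw j (List.mem_cons_of_mem _ hj)) L₂ hL₂]
    · intro j hj
      have := h2 j (List.mem_cons_of_mem _ hj)
      rwa [colourSubword_append, colourSubword_eq_nil hmono (hni j hj), List.nil_append] at this
    · intro p hp
      rcases List.mem_cons.1 (h3 p (List.mem_append_right _ hp)) with h | h
      · have : p.1 ∈ colourSubword i L₂ :=
          List.mem_map.2 ⟨p, List.mem_filter.2 ⟨hp, by simpa using h⟩, rfl⟩
        rw [hL₂i] at this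
        simp at this
      · exact h

end Words

/-! ### Indecomposable permutations and direct sums -/

namespace Permutation

theorem oneLine_length (a : Permutation) : a.oneLine.length = a.size := by
  simp [oneLine, size]

theorem oneLine_injective : Function.Injective oneLine := by
  rintro ⟨n, p⟩ ⟨m, q⟩ h
  obtain rfl : n = m := by simpa [oneLine_length, size] using congrArg List.length h
  have h' := List.ofFn_injective h
  congr 1
  ext x
  exact congrFun h' x

/-- The linear order of permutations by size and, within each size, lexicographically. -/
noncomputable abbrev letterOrder : LinearOrder Permutation :=
  LinearOrder.lift' (fun a => (toLex (a.size, a.oneLine) : ℕ ×ₗ List ℕ))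
    (fun _ _ h => oneLine_injective (congrArg (fun x => (ofLex x).2) h))

theorem letterLT_eq : LetterLT = letterOrder.lt := by
  funext a b
  exact propext (Prod.Lex.lt_iff (x := toLex (a.size, a.oneLine))
    (y := toLex (b.size, b.oneLine))).symm

/-- Labels of the points of an indecomposable permutation that increase along both axes are
constant: otherwise the points with small labels form the first summand of a direct sum. -/
theorem Indecomposable.label_eq {a : Permutation} (ha : a.Indecomposable) {β : Type*}
    [LinearOrder β] (h : Fin a.1 → β) (hh : ∀ x y, h x < h y → x < y ∧ a.2 x < a.2 y)
    (x y : Fin a.1) : h x = h y := by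
  by_contra hxy
  wlog hlt : h x < h y generalizing x y
  · exact this y x (Ne.symm hxy) (lt_of_le_of_ne (not_lt.1 hlt) (Ne.symm hxy))
  obtain ⟨n, p⟩ := a
  simp only at h hh x y hlt
  obtain ⟨c, hc1, hcn, hc⟩ : ∃ c, 1 ≤ c ∧ c < n ∧ ∀ z : Fin n, (z : ℕ) < c → (p z : ℕ) < c := by
    let A : Finset (Fin n) := Finset.univ.filter (fun z => h z ≤ h x)
    have hA : A.card + Aᶜ.card = n := by simp
    have hx : x ∈ A := by simp [A]
    have hy : y ∈ Aᶜ := by simp [A, hlt]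
    have hsep : ∀ z ∈ A, ∀ z' ∈ Aᶜ, z < z' ∧ p z < p z' := by
      intro z hz z' hz'
      simp only [A, Finset.mem_compl, Finset.mem_filter, Finset.mem_univ, true_and,
        not_le] at hz hz'
      exact hh z z' (hz.trans_lt hz')
    have h1 : 1 ≤ A.card := Finset.card_pos.2 ⟨x, hx⟩
    have h2 : 1 ≤ Aᶜ.card := Finset.card_pos.2 ⟨y, hy⟩
    refine ⟨A.card, h1, by omega, fun z hz => ?_⟩
    have hzA : z ∈ A := by
      by_contra hzA
      have : A ⊆ Finset.Iio z := fun z' hz' =>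
        Finset.mem_Iio.2 (hsep z' hz' z (Finset.mem_compl.2 hzA)).1
      have := Finset.card_le_card this
      rw [Fin.card_Iio] at this
      omega
    have : Aᶜ.map p.toEmbedding ⊆ Finset.Ioi (p z) := by
      intro z' hz'
      obtain ⟨z'', hz'', rfl⟩ := Finset.mem_map.1 hz'
      exact Finset.mem_Ioi.2 (hsep z hzA z'' hz'').2
    have := Finset.card_le_card this
    rw [Fin.card_Ioi, Finset.card_map] at this
    omega
  obtain ⟨d, rfl⟩ := Nat.exists_eq_add_of_le hcn.le
  have hmaps : Set.MapsTo (finSumFinEquiv.symm.permCongr p : Equiv.Perm (Fin c ⊕ Fin d))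
      (Set.range Sum.inl) (Set.range Sum.inl) := by
    rintro _ ⟨z, rfl⟩
    have := hc (Fin.castAdd d z) (by simp)
    refine ⟨⟨p (Fin.castAdd d z), this⟩, ?_⟩
    rw [Equiv.permCongr_apply, Equiv.eq_symm_apply]
    ext
    simp
  obtain ⟨⟨u, v⟩, huv⟩ := Equiv.Perm.mem_sumCongrHom_range_of_perm_mapsTo_inl hmaps
  refine ha.2 ⟨c, u⟩ ⟨d, v⟩ hc1 (by simp only [size]; omega) ?_
  simp only [directSum]
  rw [Equiv.Perm.sumCongrHom_apply] at huv
  simp only at huv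
  rw [huv]
  congr 1
  ext z
  simp [Equiv.permCongr_apply]

theorem directSum_castAdd (a b : Permutation) (x : Fin a.1) :
    (directSum a b).2 (Fin.castAdd b.1 x) = Fin.castAdd b.1 (a.2 x) := by
  change finSumFinEquiv
    (Equiv.Perm.sumCongr a.2 b.2 (finSumFinEquiv.symm (Fin.castAdd b.1 x))) = _
  rw [finSumFinEquiv_symm_apply_castAdd]
  rfl

theorem directSum_natAdd (a b : Permutation) (x : Fin b.1) :
    (directSum a b).2 (Fin.natAdd a.1 x) = Fin.natAdd a.1 (b.2 x) := by
  change finSumFinEquiv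
    (Equiv.Perm.sumCongr a.2 b.2 (finSumFinEquiv.symm (Fin.natAdd a.1 x))) = _
  rw [finSumFinEquiv_symm_apply_natAdd]
  rfl

/-- The points of the direct sum of a word, parametrized by the letter and the point of the
letter. -/
theorem exists_directSumList_param (w : List Permutation) :
    ∃ e : (s : Fin w.length) → Fin (w.get s).1 → Fin (directSumList w).1,
      (∀ s s' b b', s < s' → e s b < e s' b') ∧ (∀ s, StrictMono (e s)) ∧
      (∀ x, ∃ s b, e s b = x) ∧
      ∀ s b, (directSumList w).2 (e s b) = e s ((w.get s).2 b) := by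
  induction w with
  | nil => exact ⟨fun s => s.elim0, fun s => s.elim0, fun s => s.elim0, fun x => x.elim0,
      fun s => s.elim0⟩
  | cons a w ih =>
    obtain ⟨e, h1, h2, h3, h4⟩ := ih
    let e' : (s : Fin (a :: w).length) → Fin ((a :: w).get s).1 →
        Fin (a.1 + (directSumList w).1) :=
      fun s => Fin.cases (motive := fun s => Fin ((a :: w).get s).1 →
        Fin (a.1 + (directSumList w).1)) (fun b => Fin.castAdd _ b)
        (fun s b => Fin.natAdd _ (e s b)) s
    have e0 : ∀ b, e' 0 b = Fin.castAdd _ b := fun b => rfl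
    have e1 : ∀ (s : Fin w.length) b, e' s.succ b = Fin.natAdd _ (e s b) := fun s b => rfl
    refine ⟨e', ?_, ?_, ?_, ?_⟩
    · intro s s' b b' hs
      induction s using Fin.cases with
      | zero =>
        induction s' using Fin.cases with
        | zero => exact absurd hs (lt_irrefl _)
        | succ s' =>
          exact Fin.lt_def.2 (Nat.lt_of_lt_of_le b.2 (Nat.le_add_right _ _))
      | succ s =>
        induction s' using Fin.cases with
        | zero => exact absurd hs (Fin.not_lt_zero _)
        | succ s' =>
          rw [e1, e1]
          exact (Fin.natAdd_lt_natAdd_iff _).2 (h1 s s' b b' (Fin.succ_lt_succ_iff.1 hs))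
    · intro s
      induction s using Fin.cases with
      | zero => exact Fin.strictMono_castAdd _
      | succ s => exact (Fin.strictMono_natAdd _).comp (h2 s)
    · intro x
      change Fin (a.1 + (directSumList w).1) at x
      induction x using Fin.addCases with
      | left b => exact ⟨0, b, rfl⟩
      | right x =>
        obtain ⟨s, b, rfl⟩ := h3 x
        exact ⟨s.succ, b, rfl⟩
    · intro s b
      induction s using Fin.cases with
      | zero => exact directSum_castAdd a (directSumList w) b
      | succ s =>
        exact (directSum_natAdd a (directSumList w) (e s b)).trans
          (congrArg (Fin.natAdd a.1) (h4 s b))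

/-- Permutations that are isomorphic as sets of points are equal. -/
theorem eq_of_bijective {a b : Permutation} (k : Fin a.1 → Fin b.1)
    (hk : Function.Surjective k) (hx : StrictMono k)
    (hy : ∀ x y, a.2 x < a.2 y → b.2 (k x) < b.2 (k y)) : a = b := by
  obtain ⟨n, p⟩ := a
  obtain ⟨m, q⟩ := b
  simp only at k hk hx hy
  obtain rfl : n = m := by
    simpa using Fintype.card_of_bijective ⟨hx.injective, hk⟩
  have hid : ∀ f : Fin n → Fin n, StrictMono f → f = id := by
    intro f hf
    have hb : Function.Bijective f := Finite.injective_iff_bijective.1 hf.injective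
    have := Subsingleton.elim (hf.orderIsoOfSurjective f hb.2) (OrderIso.refl _)
    funext x
    exact DFunLike.congr_fun this x
  rw [hid k hx] at hy
  have h2 := hid (fun x => q (p.symm x)) (fun x y hxy => hy _ _ (by simpa using hxy))
  congr 1
  ext x
  have := congrFun h2 (p x)
  simpa using congrArg Fin.val this.symm

end Permutation

/-! ### Partitions of a direct sum into occurrences of Lyndon permutations -/

namespace Permutation

section BlockPoints

variable {B : Type*} (letter : B → Permutation)

/-- The points of the direct sum of the permutations `letter β`, where `β` runs through a linear
order. The linear order of this type is the order of the points by their first coordinates. -/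
abbrev BlockPoint : Type _ := Σₗ β : B, Fin (letter β).1

/-- The point `b` of the block `β`. -/
def blockPoint (β : B) (b : Fin (letter β).1) : BlockPoint letter := toLex ⟨β, b⟩

/-- The direct sum of the permutations `letter β`, acting on its set of points. The order of the
points `v` by their second coordinates is the order of the points `blockPerm letter v`. -/
def blockPerm : Equiv.Perm (BlockPoint letter) :=
  Equiv.sigmaCongrRight (fun β => (letter β).2)

variable {letter}

theorem exists_eq_blockPoint (v : BlockPoint letter) : ∃ β b, v = blockPoint letter β b :=
  ⟨(ofLex v).1, (ofLex v).2, rfl⟩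

theorem blockPerm_blockPoint (β : B) (b : Fin (letter β).1) :
    blockPerm letter (blockPoint letter β b) = blockPoint letter β ((letter β).2 b) := rfl

variable (letter) [LinearOrder B]

/-- An occurrence of the pattern `a`: a map of the points of `a` that preserves their order along
both axes. -/
def IsPatternMap (a : Permutation) (g : Fin a.1 → BlockPoint letter) : Prop :=
  StrictMono g ∧ ∀ x y, a.2 x < a.2 y → blockPerm letter (g x) < blockPerm letter (g y)

variable {letter}

theorem blockPoint_lt_of_lt {β γ : B} (h : β < γ) (b : Fin (letter β).1)
    (c : Fin (letter γ).1) : blockPoint letter β b < blockPoint letter γ c :=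
  Sigma.Lex.left _ _ h

theorem blockPoint_strictMono (β : B) : StrictMono (blockPoint letter β) :=
  fun _ _ h => Sigma.Lex.right _ _ h

theorem blockPoint_injective (β : B) : Function.Injective (blockPoint letter β) :=
  (blockPoint_strictMono β).injective

theorem block_le_of_lt {v v' : BlockPoint letter} (h : v < v') :
    (ofLex v).1 ≤ (ofLex v').1 := by
  obtain ⟨β, b, rfl⟩ := exists_eq_blockPoint v
  obtain ⟨γ, c, rfl⟩ := exists_eq_blockPoint v'
  by_contra hlt
  exact lt_asymm h (blockPoint_lt_of_lt (not_le.1 hlt) c b)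

theorem blockPoint_lt_blockPoint_of_block_lt {v v' : BlockPoint letter}
    (h : (ofLex v).1 < (ofLex v').1) : v < v' :=
  not_le.1 fun h' => by
    rcases h'.lt_or_eq with h' | rfl
    exacts [(block_le_of_lt h').not_gt h, lt_irrefl _ h]

/-- An occurrence of a pattern maps each indecomposable block of the pattern into a single
block. -/
theorem IsPatternMap.exists_block_map {w : List Permutation} (hw : ∀ b ∈ w, Indecomposable b)
    {e : (s : Fin w.length) → Fin (w.get s).1 → Fin (directSumList w).1}
    (he1 : ∀ s s' b b', s < s' → e s b < e s' b') (he2 : ∀ s, StrictMono (e s))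
    (he4 : ∀ s b, (directSumList w).2 (e s b) = e s ((w.get s).2 b))
    {g : Fin (directSumList w).1 → BlockPoint letter} (hg : IsPatternMap letter _ g) :
    ∃ φ : Fin w.length → B, Monotone φ ∧ ∀ s, ∃ k : Fin (w.get s).1 → Fin (letter (φ s)).1,
      (∀ b, g (e s b) = blockPoint letter (φ s) (k b)) ∧ StrictMono k ∧
      ∀ x y, (w.get s).2 x < (w.get s).2 y → (letter (φ s)).2 (k x) < (letter (φ s)).2 (k y) := by
  have hind : ∀ s, Indecomposable (w.get s) := fun s => hw _ (List.get_mem _ _)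
  have hconst : ∀ s x y, (ofLex (g (e s x))).1 = (ofLex (g (e s y))).1 := by
    intro s
    refine (hind s).label_eq _ ?_
    intro x y hxy
    constructor
    · rw [← (he2 s).lt_iff_lt, ← hg.1.lt_iff_lt]
      exact blockPoint_lt_blockPoint_of_block_lt hxy
    · rw [← (he2 s).lt_iff_lt, ← he4, ← he4]
      have h1 : blockPerm letter (g (e s x)) < blockPerm letter (g (e s y)) :=
        blockPoint_lt_blockPoint_of_block_lt hxy
      rcases lt_trichotomy ((directSumList w).2 (e s x)) ((directSumList w).2 (e s y)) with
        h | h | h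
      · exact h
      · rw [(directSumList w).2.injective h] at h1
        exact absurd h1 (lt_irrefl _)
      · exact absurd h1 (lt_asymm (hg.2 _ _ h))
  have hpos : ∀ s, 0 < (w.get s).1 := fun s => (hind s).1
  let φ : Fin w.length → B := fun s => (ofLex (g (e s ⟨0, hpos s⟩))).1
  have hk : ∀ s b, ∃ c, g (e s b) = blockPoint letter (φ s) c := by
    intro s b
    obtain ⟨β, c, h⟩ := exists_eq_blockPoint (g (e s b))
    have : φ s = β := by
      have h' := hconst s ⟨0, hpos s⟩ b
      rw [h] at h'
      exact h'
    subst this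
    exact ⟨c, h⟩
  refine ⟨φ, ?_, ?_⟩
  · intro s s' h
    rcases h.lt_or_eq with h | rfl
    · exact block_le_of_lt (hg.1 (he1 _ _ _ _ h))
    · exact le_rfl
  · intro s
    choose k hk using hk s
    refine ⟨k, hk, ?_, ?_⟩
    · intro x y hxy
      rw [← (blockPoint_strictMono (letter := letter) (φ s)).lt_iff_lt, ← hk, ← hk]
      exact hg.1 (he2 s hxy)
    · intro x y hxy
      rw [← (blockPoint_strictMono (letter := letter) (φ s)).lt_iff_lt, ← blockPerm_blockPoint,
        ← blockPerm_blockPoint, ← hk, ← hk]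
      refine hg.2 _ _ ?_
      rw [he4, he4]
      exact he2 s hxy

end BlockPoints

section Lyndon

variable {ι : Type*} [LinearOrder ι] (w : ι → List Permutation)

/-- The blocks of the direct sum of the permutations with block words `w i`. -/
abbrev WordBlock : Type _ := Σₗ i : ι, Fin (w i).length

/-- The indecomposable permutation that forms a block. -/
def wordLetter (β : WordBlock w) : Permutation := (w (ofLex β).1).get (ofLex β).2

theorem wordBlock_lt_of_lt {w : ι → List Permutation} {i j : ι} (h : i < j)
    (s : Fin (w i).length) (t : Fin (w j).length) :
    (toLex ⟨i, s⟩ : WordBlock w) < toLex ⟨j, t⟩ :=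
  Sigma.Lex.left _ _ h

theorem wordBlock_strictMono {w : ι → List Permutation} (i : ι) :
    StrictMono (fun s : Fin (w i).length => (toLex ⟨i, s⟩ : WordBlock w)) :=
  fun _ _ h => Sigma.Lex.right _ _ h

theorem list_eq_of_pairwise_lt {β : Type*} [LinearOrder β] {l l' : List β}
    (h : l.Pairwise (· < ·)) (h' : l'.Pairwise (· < ·)) (hmem : ∀ x, x ∈ l ↔ x ∈ l') :
    l = l' := by
  refine List.Perm.eq_of_pairwise (le := (· < ·))
    (fun a b _ _ hab hba => absurd hab (lt_asymm hba)) h h' ?_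
  exact (List.perm_ext_iff_of_nodup (h.imp ne_of_lt) (h'.imp ne_of_lt)).2 hmem

/-- If the direct sum of permutations with strictly decreasing Lyndon block words is partitioned
into occurrences of these permutations, then each occurrence is the trivial one. -/
theorem block_eq_of_isPatternMap [Fintype ι] (hind : ∀ i, ∀ b ∈ w i, Indecomposable b)
    (hlyn : ∀ i, IsLyndonWord LetterLT (w i))
    (hdec : ∀ i j, i < j → List.Lex LetterLT (w j) (w i))
    (g : (i : ι) → Fin (directSumList (w i)).1 → BlockPoint (wordLetter w))
    (hg : ∀ i, IsPatternMap (wordLetter w) _ (g i)) (hsurj : ∀ v, ∃ i x, g i x = v)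
    (i : ι) (x : Fin (directSumList (w i)).1) : (ofLex (ofLex (g i x)).1).1 = i := by
  classical
  choose e he1 he2 he3 he4 using fun i => exists_directSumList_param (w i)
  choose φ hφmono k hk hkmono hkperm using fun i =>
    (hg i).exists_block_map (hind i) (he1 i) (he2 i) (he4 i)
  let Φ : WordBlock w → WordBlock w := fun β => φ (ofLex β).1 (ofLex β).2
  have hpos : ∀ β : WordBlock w, 0 < (wordLetter w β).1 :=
    fun β => (hind _ _ (List.get_mem _ _)).1
  have hex : ∀ β (b : Fin (wordLetter w β).1), ∃ γ c, Φ γ = β ∧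
      g (ofLex γ).1 (e (ofLex γ).1 (ofLex γ).2 c) = blockPoint (wordLetter w) β b := by
    intro β b
    obtain ⟨i, x, hx⟩ := hsurj (blockPoint (wordLetter w) β b)
    obtain ⟨s, c, rfl⟩ := he3 i x
    refine ⟨toLex ⟨i, s⟩, c, ?_, hx⟩
    have := (hk i s c).symm.trans hx
    exact congrArg (fun v => (ofLex v).1) this
  have hΦs : Function.Surjective Φ := by
    intro β
    obtain ⟨γ, c, h, -⟩ := hex β ⟨0, hpos β⟩
    exact ⟨γ, h⟩
  have hΦ : Function.Bijective Φ := Finite.surjective_iff_bijective.1 hΦs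
  have hletter : ∀ β, wordLetter w β = wordLetter w (Φ β) := by
    intro β
    refine eq_of_bijective (k (ofLex β).1 (ofLex β).2) ?_ (hkmono _ _) (hkperm _ _)
    intro b
    obtain ⟨γ, c, h, h'⟩ := hex (Φ β) b
    obtain rfl := hΦ.1 h
    exact ⟨c, blockPoint_injective _ ((hk _ _ c).symm.trans h')⟩
  have hφstrict : ∀ i, StrictMono (φ i) := by
    intro i
    refine (hφmono i).strictMono_of_injective ?_
    intro s t hst
    have : (toLex ⟨i, s⟩ : WordBlock w) = toLex ⟨i, t⟩ := hΦ.1 hst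
    exact (wordBlock_strictMono i).injective this
  -- the word of all blocks, coloured by the occurrence that a block belongs to
  let Ψ := (Equiv.ofBijective Φ hΦ).symm
  have hΨ : ∀ β, Ψ (Φ β) = β := (Equiv.ofBijective Φ hΦ).symm_apply_apply
  let BL : List (WordBlock w) := Finset.univ.sort (· ≤ ·)
  let is : List ι := Finset.univ.sort (· ≤ ·)
  have hBLs : BL.Pairwise (· < ·) := Finset.sortedLT_sort _ |>.pairwise
  have hiss : is.Pairwise (· < ·) := Finset.sortedLT_sort _ |>.pairwise
  have hBLmem : ∀ β, β ∈ BL := by simp [BL]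
  have hismem : ∀ i, i ∈ is := by simp [is]
  have hBL : BL = is.flatMap (fun i => List.ofFn (fun s => (toLex ⟨i, s⟩ : WordBlock w))) := by
    refine list_eq_of_pairwise_lt hBLs ?_ ?_
    · rw [List.pairwise_flatMap]
      refine ⟨fun i _ => ?_, hiss.imp ?_⟩
      · exact List.pairwise_ofFn.2 fun s t h => wordBlock_strictMono i h
      · intro i j hij x hx y hy
        obtain ⟨s, rfl⟩ := (List.mem_ofFn' _ _).1 hx
        obtain ⟨t, rfl⟩ := (List.mem_ofFn' _ _).1 hy
        exact wordBlock_lt_of_lt hij s t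
    · intro β
      simp only [hBLmem, true_iff, List.mem_flatMap]
      exact ⟨(ofLex β).1, hismem _, (List.mem_ofFn' _ _).2 ⟨(ofLex β).2, rfl⟩⟩
  let _ : LinearOrder Permutation := letterOrder
  rw [letterLT_eq] at hlyn hdec
  let L : List (Permutation × ι) := BL.map (fun β => (wordLetter w β, (ofLex (Ψ β)).1))
  have hofFn : ∀ i, List.ofFn (fun s => wordLetter w (toLex ⟨i, s⟩)) = w i :=
    fun i => List.ofFn_get (w i)
  have hcol := colours_eq_of_colourSubword_eq w is (hiss.imp fun {i j} h => hdec i j h)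
    (fun i _ => hlyn i) L ?_ ?_ ?_
  · have hcol' : BL.map (fun β => (ofLex (Ψ β)).1) = BL.map (fun β => (ofLex β).1) := by
      have h1 : L.map Prod.snd = BL.map (fun β => (ofLex (Ψ β)).1) := by simp [L, Function.comp_def]
      rw [← h1, hcol]
      rw [hBL, List.map_flatMap]
      congr 1
      funext i
      rw [List.map_ofFn]
      simp [Function.comp_def, List.ofFn_const]
    have hcol'' := List.map_inj_left.1 hcol'
    obtain ⟨s, b, rfl⟩ := he3 i x
    rw [hk]
    have := hcol'' (φ i s) (hBLmem _)
    have h3 : Ψ (φ i s) = toLex ⟨i, s⟩ := hΨ (toLex ⟨i, s⟩)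
    rw [h3] at this
    exact this.symm
  · have h1 : L.map Prod.fst = BL.map (wordLetter w) := by simp [L, Function.comp_def]
    rw [h1, hBL, List.map_flatMap]
    congr 1
    funext i
    rw [List.map_ofFn]
    exact hofFn i
  · intro i _
    have h1 : colourSubword i L =
        (BL.filter (fun β => (ofLex (Ψ β)).1 = i)).map (wordLetter w) := by
      simp [colourSubword, L, List.filter_map, Function.comp_def]
    have h2 : BL.filter (fun β => (ofLex (Ψ β)).1 = i) = List.ofFn (φ i) := by
      refine list_eq_of_pairwise_lt (hBLs.filter _)
        (List.pairwise_ofFn.2 fun s t h => hφstrict i h) ?_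
      intro β
      rw [List.mem_filter, List.mem_ofFn']
      simp only [hBLmem, true_and, decide_eq_true_eq]
      constructor
      · rintro rfl
        exact ⟨(ofLex (Ψ β)).2, (Equiv.ofBijective Φ hΦ).apply_symm_apply β⟩
      · rintro ⟨s, rfl⟩
        have h3 : Ψ (φ i s) = toLex ⟨i, s⟩ := hΨ (toLex ⟨i, s⟩)
        rw [h3]
        rfl
    rw [h1, h2, List.map_ofFn]
    refine Eq.trans ?_ (hofFn i)
    congr 1
    funext s
    exact (hletter (toLex ⟨i, s⟩)).symm
  · intro p _
    exact hismem _

end Lyndon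

end Permutation

/-! ### Blow-ups and their densities -/

section AxisMap

variable {N : ℕ}

/-- The continuous piecewise linear function that vanishes for `z ≤ 0` and has the slope `s j`
between `j` and `j + 1`. -/
def axisMap (s : Fin N → ℝ) (z : ℝ) : ℝ := ∑ j, s j * max 0 (min 1 (z - (j : ℕ)))

theorem continuous_axisMap (s : Fin N → ℝ) : Continuous (axisMap s) := by
  unfold axisMap
  fun_prop

theorem monotone_axisMap {s : Fin N → ℝ} (hs : ∀ j, 0 < s j) : Monotone (axisMap s) := by
  intro z z' h
  refine Finset.sum_le_sum fun j _ => mul_le_mul_of_nonneg_left ?_ (hs j).le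
  gcongr

theorem axisMap_add (s : Fin N → ℝ) (j : Fin N) {u : ℝ} (h0 : 0 ≤ u) (h1 : u ≤ 1) :
    axisMap s ((j : ℕ) + u) = axisMap s (j : ℕ) + s j * u := by
  have h : ∀ i : Fin N, s i * max 0 (min 1 (((j : ℕ) : ℝ) + u - (i : ℕ))) =
      s i * max 0 (min 1 (((j : ℕ) : ℝ) - (i : ℕ))) + if i = j then s j * u else 0 := by
    intro i
    rcases lt_trichotomy i j with hij | rfl | hij
    · have : ((i : ℕ) : ℝ) + 1 ≤ (j : ℕ) := by exact_mod_cast hij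
      rw [if_neg hij.ne, min_eq_left (by linarith), min_eq_left (by linarith), add_zero]
    · simp [h0, h1]
    · have : ((j : ℕ) : ℝ) + 1 ≤ (i : ℕ) := by exact_mod_cast hij
      rw [if_neg hij.ne', max_eq_left ((min_le_right _ _).trans (by linarith)),
        max_eq_left ((min_le_right _ _).trans (by linarith)), add_zero]
  unfold axisMap
  rw [Finset.sum_congr rfl fun i _ => h i, Finset.sum_add_distrib]
  simp

theorem axisMap_zero (s : Fin N → ℝ) : axisMap s 0 = 0 := by
  refine Finset.sum_eq_zero fun j _ => ?_
  have : (0 : ℝ) ≤ (j : ℕ) := Nat.cast_nonneg _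
  rw [max_eq_left ((min_le_right _ _).trans (by linarith)), mul_zero]

theorem axisMap_top (s : Fin N → ℝ) : axisMap s N = ∑ j, s j := by
  refine Finset.sum_congr rfl fun j _ => ?_
  have : ((j : ℕ) : ℝ) + 1 ≤ N := by exact_mod_cast j.2
  rw [min_eq_left (by linarith), max_eq_right zero_le_one, mul_one]

theorem axisMap_mem {s : Fin N → ℝ} (hs : ∀ j, 0 < s j) (hsum : ∑ j, s j = 1) (z : ℝ) :
    axisMap s z ∈ Set.Icc (0 : ℝ) 1 := by
  constructor
  · exact Finset.sum_nonneg fun j _ => mul_nonneg (hs j).le (le_max_left _ _)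
  · rw [← hsum]
    refine Finset.sum_le_sum fun j _ => mul_le_of_le_one_right (hs j).le ?_
    exact max_le zero_le_one (min_le_left _ _)

theorem strictMonoOn_axisMap {s : Fin N → ℝ} (hs : ∀ j, 0 < s j) :
    StrictMonoOn (axisMap s) (Set.Icc 0 N) := by
  intro z hz z' hz' h
  have hN : ⌊z⌋₊ < N := (Nat.floor_lt hz.1).2 (h.trans_le hz'.2)
  have h1 := Nat.floor_le hz.1
  have h2 := Nat.lt_floor_add_one z
  refine Finset.sum_lt_sum (fun j _ => mul_le_mul_of_nonneg_left (by gcongr) (hs j).le)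
    ⟨⟨⌊z⌋₊, hN⟩, Finset.mem_univ _, mul_lt_mul_of_pos_left ?_ (hs _)⟩
  simp only
  rw [min_eq_right (by linarith), max_eq_right (by linarith)]
  exact lt_max_of_lt_right (lt_min (by linarith) (by linarith))

/-- On the points `i + u` with `u ∈ [0, 1]`, the map `axisMap s` preserves and reflects the strict
order. This includes the ties `i + 1 = (i + 1) + 0`. -/
theorem axisMap_lt_iff {s : Fin N → ℝ} (hs : ∀ j, 0 < s j) (i j : Fin N) (u v : unitInterval) :
    axisMap s ((i : ℕ) + u) < axisMap s ((j : ℕ) + v) ↔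
      ((i : ℕ) + u : ℝ) < (j : ℕ) + v := by
  have hmem : ∀ (i : Fin N) (u : unitInterval), ((i : ℕ) + u : ℝ) ∈ Set.Icc (0 : ℝ) N := by
    intro i u
    have : ((i : ℕ) : ℝ) + 1 ≤ N := by exact_mod_cast i.2
    exact ⟨add_nonneg (Nat.cast_nonneg _) u.2.1, by linarith [u.2.2]⟩
  exact (strictMonoOn_axisMap hs).lt_iff_lt (hmem i u) (hmem j v)

theorem sum_restrict_Ioc {S : ℕ → ℝ} (hS : Monotone S) (n : ℕ) :
    ∑ j ∈ Finset.range n, (volume : Measure ℝ).restrict (Set.Ioc (S j) (S (j + 1))) =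
      volume.restrict (Set.Ioc (S 0) (S n)) := by
  induction n with
  | zero => simp
  | succ n ih =>
    rw [Finset.sum_range_succ, ih, ← Measure.restrict_union _ measurableSet_Ioc,
      Set.Ioc_union_Ioc_eq_Ioc (hS (Nat.zero_le n)) (hS (Nat.le_succ n))]
    exact Set.disjoint_left.2 fun x hx hx' => absurd hx.2 (not_le.2 hx'.1)

theorem smul_map_affine (x : ℝ) {c : ℝ} (hc : 0 < c) :
    ENNReal.ofReal c • (volume.restrict (Set.Icc (0 : ℝ) 1)).map (fun u => x + c * u) =
      volume.restrict (Set.Ioc x (x + c)) := by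
  have hf : Measurable (fun u : ℝ => x + c * u) := by fun_prop
  have hpre : (fun u : ℝ => x + c * u) ⁻¹' Set.Icc x (x + c) = Set.Icc 0 1 := by
    ext u
    simp only [Set.mem_preimage, Set.mem_Icc, le_add_iff_nonneg_right, add_le_add_iff_left]
    rw [mul_nonneg_iff_of_pos_left hc, mul_le_iff_le_one_right hc]
  have hmap : ENNReal.ofReal c • (volume : Measure ℝ).map (fun u => x + c * u) = volume := by
    have h1 : (fun u : ℝ => x + c * u) = (fun v => x + v) ∘ (fun u => c * u) := rfl
    rw [h1, ← Measure.map_map (by fun_prop) (by fun_prop), ← Measure.map_smul]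
    have := Real.smul_map_volume_mul_left hc.ne'
    rw [abs_of_pos hc] at this
    rw [this, map_add_left_eq_self]
  rw [restrict_Ioc_eq_restrict_Icc, ← hpre, ← Measure.restrict_map hf measurableSet_Icc,
    ← Measure.restrict_smul, hmap]

/-- Choosing the interval between `j` and `j + 1` with probability `s j` and a uniform point in it
yields the uniform distribution of `[0, 1]` under `axisMap s`. -/
theorem sum_smul_map_axisMap {s : Fin N → ℝ} (hs : ∀ j, 0 < s j) (hsum : ∑ j, s j = 1) :
    ∑ j : Fin N, ENNReal.ofReal (s j) • (volume : Measure unitInterval).map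
      (fun u : unitInterval =>
        (⟨axisMap s ((j : ℕ) + u), axisMap_mem hs hsum _⟩ : unitInterval)) = volume := by
  have hemb : MeasurableEmbedding ((↑) : unitInterval → ℝ) :=
    MeasurableEmbedding.subtype_coe measurableSet_Icc
  have hvol : (volume : Measure unitInterval).map (↑) = volume.restrict (Set.Icc (0 : ℝ) 1) :=
    map_comap_subtype_coe measurableSet_Icc _
  have hmeas : ∀ j : Fin N, Measurable
      (fun u : unitInterval => (⟨axisMap s ((j : ℕ) + u), axisMap_mem hs hsum _⟩ : unitInterval)) :=
    fun j => Measurable.subtype_mk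
      ((continuous_axisMap s).measurable.comp (measurable_subtype_coe.const_add _))
  have hterm : ∀ j : Fin N, (ENNReal.ofReal (s j) • (volume : Measure unitInterval).map
      (fun u : unitInterval =>
        (⟨axisMap s ((j : ℕ) + u), axisMap_mem hs hsum _⟩ : unitInterval))).map (↑) =
      (volume : Measure ℝ).restrict
        (Set.Ioc (axisMap s (j : ℕ)) (axisMap s ((j : ℕ) + 1 : ℕ))) := by
    intro j
    rw [Measure.map_smul, Measure.map_map measurable_subtype_coe (hmeas j)]
    have h1 : ((↑) : unitInterval → ℝ) ∘ (fun u : unitInterval =>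
        (⟨axisMap s ((j : ℕ) + u), axisMap_mem hs hsum _⟩ : unitInterval)) =
        (fun u : ℝ => axisMap s (j : ℕ) + s j * u) ∘ (↑) := by
      funext u
      exact axisMap_add s j u.2.1 u.2.2
    rw [h1, ← Measure.map_map (by fun_prop) measurable_subtype_coe, hvol, smul_map_affine _ (hs j),
      Nat.cast_succ, axisMap_add s j zero_le_one le_rfl, mul_one]
  have hcoe : ∀ μ ν : Measure unitInterval, μ.map ((↑) : unitInterval → ℝ) = ν.map (↑) →
      μ = ν := by
    intro μ ν h
    ext A hA
    rw [← Set.preimage_image_eq A Subtype.val_injective, ← hemb.map_apply, ← hemb.map_apply, h]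
  apply hcoe
  rw [← Measure.mapₗ_apply_of_measurable measurable_subtype_coe, map_sum]
  simp only [Measure.mapₗ_apply_of_measurable measurable_subtype_coe]
  rw [Finset.sum_congr rfl fun j _ => hterm j, hvol,
    Fin.sum_univ_eq_sum_range (fun j : ℕ => (volume : Measure ℝ).restrict
      (Set.Ioc (axisMap s (j : ℕ)) (axisMap s ((j + 1 : ℕ) : ℝ)))) N,
    sum_restrict_Ioc (S := fun n : ℕ => axisMap s n)
      ((monotone_axisMap hs).comp Nat.mono_cast)]
  simp only [Nat.cast_zero]
  rw [axisMap_zero, axisMap_top, hsum, restrict_Ioc_eq_restrict_Icc]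

end AxisMap

/-- A product of finite mixtures of measures is a mixture of product measures. -/
theorem MeasureTheory.Measure.pi_sum_smul {V ι : Type*} [Fintype V] [Fintype ι] [DecidableEq ι]
    {Ω : Type*} [MeasurableSpace Ω] (c : V → ENNReal) (μ : V → Measure Ω)
    [∀ v, SigmaFinite (μ v)] [SigmaFinite (∑ v, c v • μ v)] :
    Measure.pi (fun _ : ι => ∑ v, c v • μ v) =
      ∑ f : ι → V, (∏ i, c (f i)) • Measure.pi (fun i => μ (f i)) := by
  refine Measure.pi_eq fun s _ => ?_
  simp only [Measure.finsetSum_apply, Measure.smul_apply, smul_eq_mul, Measure.pi_pi]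
  rw [Finset.prod_univ_sum, Fintype.piFinset_univ]
  simp only [Finset.prod_mul_distrib]

namespace Permutation

theorem measurableSet_inducedBy (a : Permutation) :
    MeasurableSet {p : Fin a.1 → unitInterval × unitInterval | a.InducedBy p} := by
  simp only [InducedBy, StrictMono, Set.ofPred_exists, Set.ofPred_and, Set.ofPred_forall]
  refine MeasurableSet.iUnion fun τ => (MeasurableSet.iInter fun i => MeasurableSet.iInter fun j =>
    MeasurableSet.iInter fun _ => measurableSet_lt (by fun_prop) (by fun_prop)).inter
    (MeasurableSet.iInter fun i => MeasurableSet.iInter fun j => ?_)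
  by_cases h : a.2 i < a.2 j
  · simp only [h, true_iff]
    exact measurableSet_lt (by fun_prop) (by fun_prop)
  · simp only [h, false_iff]
    exact (measurableSet_lt (by fun_prop) (by fun_prop)).compl

/-- The points with coordinates `x i` and `y i` induce the permutation `a`. -/
def PlaneInduced (a : Permutation) (x y : Fin a.1 → ℝ) : Prop :=
  ∃ τ : Equiv.Perm (Fin a.1), StrictMono (fun i => x (τ i)) ∧
    ∀ i j : Fin a.1, a.2 i < a.2 j ↔ y (τ i) < y (τ j)

section Blowup

variable {V : Type*} {N : ℕ} (X Y : V ≃ Fin N)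

/-- The probability that random points of the unit squares with the lower left corners
`(X (f i), Y (f i))`, chosen independently and uniformly on the diagonals, induce the
permutation `a`. -/
noncomputable def blowupCoeff (a : Permutation) (f : Fin a.1 → V) : ℝ :=
  (volume : Measure (Fin a.1 → unitInterval)).real
    {u | a.PlaneInduced (fun i => ((X (f i) : ℕ) : ℝ) + u i) (fun i => ((Y (f i) : ℕ) : ℝ) + u i)}

theorem blowupCoeff_nonneg (a : Permutation) (f : Fin a.1 → V) : 0 ≤ blowupCoeff X Y a f :=
  measureReal_nonneg

variable [Fintype V] {t : V → ℝ} (ht : ∀ v, 0 < t v) (hsum : ∑ v, t v = 1)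

/-- The diagonal of the rectangle that the point `v` is blown up to. -/
noncomputable def blowupCurve (v : V) (u : unitInterval) : unitInterval × unitInterval :=
  (⟨axisMap (t ∘ X.symm) ((X v : ℕ) + u), axisMap_mem (fun _ => ht _)
      ((Equiv.sum_comp X.symm t).trans hsum) _⟩,
    ⟨axisMap (t ∘ Y.symm) ((Y v : ℕ) + u), axisMap_mem (fun _ => ht _)
      ((Equiv.sum_comp Y.symm t).trans hsum) _⟩)

theorem measurable_blowupCurve (v : V) : Measurable (blowupCurve X Y ht hsum v) := by
  refine Measurable.prodMk ?_ ?_ <;>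
  exact Measurable.subtype_mk
    ((continuous_axisMap _).measurable.comp (measurable_subtype_coe.const_add _))

/-- The permuton in which each point `v`, with the horizontal rank `X v` and the vertical rank
`Y v`, is replaced by an increasing diagonal of mass `t v`. -/
noncomputable def blowup : Permuton where
  measure := ∑ v, ENNReal.ofReal (t v) • volume.map (blowupCurve X Y ht hsum v)
  isProbabilityMeasure := by
    have (v : V) : IsProbabilityMeasure (volume.map (blowupCurve X Y ht hsum v)) :=
      Measure.isProbabilityMeasure_map (measurable_blowupCurve X Y ht hsum v).aemeasurable
    constructor
    simp only [Measure.finsetSum_apply, Measure.smul_apply, smul_eq_mul, measure_univ, mul_one]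
    rw [← ENNReal.ofReal_sum_of_nonneg fun v _ => (ht v).le, hsum, ENNReal.ofReal_one]
  map_fst := by
    rw [← Measure.mapₗ_apply_of_measurable measurable_fst, map_sum]
    simp only [Measure.mapₗ_apply_of_measurable measurable_fst]
    refine Eq.trans ?_ (sum_smul_map_axisMap (s := t ∘ X.symm) (fun _ => ht _)
      ((Equiv.sum_comp X.symm t).trans hsum))
    rw [← Equiv.sum_comp X]
    refine Finset.sum_congr rfl fun v _ => ?_
    rw [Measure.map_smul, Measure.map_map measurable_fst (measurable_blowupCurve X Y ht hsum v)]
    simp only [Function.comp_apply, Equiv.symm_apply_apply]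
    rfl
  map_snd := by
    rw [← Measure.mapₗ_apply_of_measurable measurable_snd, map_sum]
    simp only [Measure.mapₗ_apply_of_measurable measurable_snd]
    refine Eq.trans ?_ (sum_smul_map_axisMap (s := t ∘ Y.symm) (fun _ => ht _)
      ((Equiv.sum_comp Y.symm t).trans hsum))
    rw [← Equiv.sum_comp Y]
    refine Finset.sum_congr rfl fun v _ => ?_
    rw [Measure.map_smul, Measure.map_map measurable_snd (measurable_blowupCurve X Y ht hsum v)]
    simp only [Function.comp_apply, Equiv.symm_apply_apply]
    rfl

theorem inducedBy_blowupCurve_iff (a : Permutation) (f : Fin a.1 → V)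
    (u : Fin a.1 → unitInterval) :
    a.InducedBy (fun i => blowupCurve X Y ht hsum (f i) (u i)) ↔
      a.PlaneInduced (fun i => ((X (f i) : ℕ) : ℝ) + u i)
        (fun i => ((Y (f i) : ℕ) : ℝ) + u i) := by
  have hx : ∀ i j, (blowupCurve X Y ht hsum (f i) (u i)).1 <
      (blowupCurve X Y ht hsum (f j) (u j)).1 ↔
      ((X (f i) : ℕ) : ℝ) + u i < ((X (f j) : ℕ) : ℝ) + u j :=
    fun i j => axisMap_lt_iff (fun _ => ht _) _ _ _ _
  have hy : ∀ i j, (blowupCurve X Y ht hsum (f i) (u i)).2 <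
      (blowupCurve X Y ht hsum (f j) (u j)).2 ↔
      ((Y (f i) : ℕ) : ℝ) + u i < ((Y (f j) : ℕ) : ℝ) + u j :=
    fun i j => axisMap_lt_iff (fun _ => ht _) _ _ _ _
  simp only [InducedBy, PlaneInduced, StrictMono, hx, hy]

/-- The density of a permutation in a blow-up is a polynomial of the masses. -/
theorem density_blowup (a : Permutation) :
    a.density (blowup X Y ht hsum) = ∑ f : Fin a.1 → V, blowupCoeff X Y a f * ∏ i, t (f i) := by
  have hP : IsProbabilityMeasure (∑ v, ENNReal.ofReal (t v) •
      volume.map (blowupCurve X Y ht hsum v)) := (blowup X Y ht hsum).isProbabilityMeasure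
  have (v : V) : IsProbabilityMeasure (volume.map (blowupCurve X Y ht hsum v)) :=
    Measure.isProbabilityMeasure_map (measurable_blowupCurve X Y ht hsum v).aemeasurable
  unfold density blowup
  simp only
  rw [Measure.pi_sum_smul, measureReal_def, Measure.finsetSum_apply,
    ENNReal.toReal_sum]
  · refine Finset.sum_congr rfl fun f _ => ?_
    rw [Measure.smul_apply, smul_eq_mul, ENNReal.toReal_mul, ENNReal.toReal_prod, mul_comm]
    congr 1
    · rw [← Measure.pi_map_pi fun i => (measurable_blowupCurve X Y ht hsum (f i)).aemeasurable,
        Measure.map_apply (by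
          have := measurable_blowupCurve X Y ht hsum
          fun_prop) (measurableSet_inducedBy a)]
      simp only [Set.preimage_ofPred_eq, inducedBy_blowupCurve_iff]
      rfl
    · exact Finset.prod_congr rfl fun i _ => ENNReal.toReal_ofReal (ht _).le
  · intro f _
    rw [Measure.smul_apply, smul_eq_mul]
    exact ENNReal.mul_ne_top (ENNReal.prod_ne_top fun _ _ => ENNReal.ofReal_ne_top)
      (measure_ne_top _ _)

end Blowup

end Permutation

/-! ### Openness of polynomial maps -/

section PolynomialMap

variable {V ι : Type*} [Fintype V] [DecidableEq V] {κ : ι → Type*} [∀ i, Fintype (κ i)]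

theorem sum_single_eq_iff_bijective [Fintype ι] (F : (i : ι) → κ i → V) :
    ∑ i, ∑ x, Finsupp.single (F i x) 1 = Finsupp.equivFunOnFinite.symm (fun _ : V => (1 : ℕ)) ↔
      Function.Bijective (fun q : Σ i, κ i => F q.1 q.2) := by
  classical
  rw [← Fintype.sum_sigma' (f := fun i x => Finsupp.single (F i x) 1),
    Function.bijective_iff_existsUnique, Finsupp.ext_iff]
  refine forall_congr' fun v => ?_
  simp only [Finsupp.finsetSum_apply, Finsupp.single_apply, Finset.sum_boole, Nat.cast_id,
    Finsupp.equivFunOnFinite_symm_apply_apply]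
  rw [Finset.card_eq_one]
  simp only [Finset.ext_iff, Finset.mem_filter, Finset.mem_univ, true_and, Finset.mem_singleton]
  constructor
  · rintro ⟨q, hq⟩
    exact ⟨q, (hq q).2 rfl, fun q' h => (hq q').1 h⟩
  · rintro ⟨q, hq, hq'⟩
    exact ⟨q, fun q' => ⟨hq' q', fun h => h ▸ hq⟩⟩

variable [∀ i, DecidableEq (κ i)]

/-- The polynomial map whose `i`-th coordinate is homogeneous of degree `|κ i|`, with the
coefficients `c i f` of the monomials `∏ x, X (f x)`. -/
noncomputable def tupleSum (c : (i : ι) → (κ i → V) → ℝ) (t : V → ℝ) (i : ι) : ℝ :=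
  ∑ f : κ i → V, c i f * ∏ x, t (f x)

/-- The operator `X_v ∂ / ∂ X_v` multiplies a monomial by its degree in `X_v`; on the side of
the total derivative `D`, this is the direction `Pi.single v (t v)`. -/
theorem HasStrictFDerivAt.tupleSum [Fintype ι] (c : (i : ι) → (κ i → V) → ℝ) (t : V → ℝ) :
    ∃ D : (V → ℝ) →L[ℝ] (ι → ℝ), HasStrictFDerivAt (tupleSum c) D t ∧ ∀ v i,
      D (Pi.single v (t v)) i =
        ∑ f : κ i → V, c i f * (Finset.univ.filter (fun x => f x = v)).card * ∏ x, t (f x) := by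
  refine ⟨ContinuousLinearMap.pi fun i => ∑ f : κ i → V, c i f • ∑ x,
    (∏ y ∈ Finset.univ.erase x, t (f y)) • ContinuousLinearMap.proj (f x), ?_, ?_⟩
  · refine hasStrictFDerivAt_pi.2 fun i => HasStrictFDerivAt.fun_sum fun f _ => ?_
    refine HasStrictFDerivAt.const_mul (HasStrictFDerivAt.finsetProd fun x _ => ?_) _
    exact (ContinuousLinearMap.proj (R := ℝ) (φ := fun _ : V => ℝ) (f x)).hasStrictFDerivAt
  · intro v i
    simp only [ContinuousLinearMap.coe_pi', sum_apply,
      smul_apply, ContinuousLinearMap.proj_apply, smul_eq_mul]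
    refine Finset.sum_congr rfl fun f _ => ?_
    rw [mul_assoc]
    congr 1
    rw [← nsmul_eq_mul, ← Finset.sum_const, Finset.sum_filter]
    refine Finset.sum_congr rfl fun x _ => ?_
    split_ifs with h
    · rw [← h, Pi.single_eq_same, Finset.prod_erase_mul _ _ (Finset.mem_univ x)]
    · rw [Pi.single_eq_of_ne h, mul_zero]

/-- The coefficient of the product of all variables in the determinant of the matrix of the
polynomials `X_{p j} ∂ P_i / ∂ X_{p j}` is a signed sum over the bijections
`Σ i, κ i → V`. Only the identity permutation contributes to it, so it is positive. -/
theorem exists_map_nhds_tupleSum_eq [Fintype ι] (c : (i : ι) → (κ i → V) → ℝ)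
    (hc : ∀ i f, 0 ≤ c i f) (p : ι → V)
    (huniq : ∀ F : (i : ι) → κ i → V, Function.Bijective (fun q : Σ i, κ i => F q.1 q.2) →
      (∀ i, c i (F i) ≠ 0) → ∀ i j x, F i x = p j → j = i)
    (hex : ∃ F : (i : ι) → κ i → V, Function.Bijective (fun q : Σ i, κ i => F q.1 q.2) ∧
      (∀ i, c i (F i) ≠ 0) ∧ ∀ i, ∃ x, F i x = p i) :
    ∃ t : V → ℝ, (∀ v, 0 < t v) ∧
      Filter.map (tupleSum c) (nhds t) = nhds (tupleSum c t) := by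
  classical
  let cnt (i j : ι) (f : κ i → V) : ℝ := c i f * (Finset.univ.filter (fun x => f x = p j)).card
  have hcnt : ∀ i j f, 0 ≤ cnt i j f := fun i j f => mul_nonneg (hc i f) (Nat.cast_nonneg _)
  let M : Matrix ι ι (MvPolynomial V ℝ) := Matrix.of fun j i =>
    ∑ f : κ i → V, MvPolynomial.C (cnt i j f) * ∏ x, MvPolynomial.X (f x)
  let m : V →₀ ℕ := Finsupp.equivFunOnFinite.symm (fun _ => 1)
  have hcoeff : ∀ π : Equiv.Perm ι, MvPolynomial.coeff m (∏ i, M (π i) i) =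
      ∑ F : (i : ι) → κ i → V, if ∑ i, ∑ x, Finsupp.single (F i x) 1 = m then
        ∏ i, cnt i (π i) (F i) else 0 := by
    intro π
    simp only [M, Matrix.of_apply]
    rw [Finset.prod_univ_sum, Fintype.piFinset_univ, MvPolynomial.coeff_sum]
    refine Finset.sum_congr rfl fun F _ => ?_
    rw [← MvPolynomial.coeff_monomial, MvPolynomial.monomial_sum_index, Finset.prod_mul_distrib,
      map_prod]
    simp only [MvPolynomial.monomial_sum_index, map_one, one_mul]
    rfl
  have hne : MvPolynomial.coeff m M.det ≠ 0 := by
    rw [Matrix.det_apply', MvPolynomial.coeff_sum, Finset.sum_eq_single 1]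
    · simp only [Equiv.Perm.sign_one, Units.val_one, Int.cast_one, one_mul]
      rw [hcoeff]
      obtain ⟨F, hF, hF1, hF2⟩ := hex
      refine (lt_of_lt_of_le ?_ (Finset.single_le_sum (fun F _ => ?_) (Finset.mem_univ F))).ne'
      · rw [if_pos ((sum_single_eq_iff_bijective F).2 hF)]
        refine Finset.prod_pos fun i _ => mul_pos ((hc _ _).lt_of_ne' (hF1 i)) ?_
        obtain ⟨x, hx⟩ := hF2 i
        exact_mod_cast Finset.card_pos.2 ⟨x, Finset.mem_filter.2 ⟨Finset.mem_univ x, hx⟩⟩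
      · split_ifs
        exacts [Finset.prod_nonneg fun i _ => hcnt _ _ _, le_rfl]
    · intro π _ hπ
      have hzero : MvPolynomial.coeff m (∏ i, M (π i) i) = 0 := by
        rw [hcoeff]
        refine Finset.sum_eq_zero fun F _ => ?_
        split_ifs with h
        · by_contra hprod
          rw [← Ne, Finset.prod_ne_zero_iff] at hprod
          refine hπ (Equiv.ext fun i => ?_)
          have h1 := hprod i (Finset.mem_univ i)
          have h2 : (Finset.univ.filter (fun x => F i x = p (π i))).card ≠ 0 := by
            exact_mod_cast right_ne_zero_of_mul h1
          obtain ⟨x, hx⟩ := Finset.card_pos.1 (Nat.pos_of_ne_zero h2)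
          exact huniq F ((sum_single_eq_iff_bijective F).1 h)
            (fun i => left_ne_zero_of_mul (hprod i (Finset.mem_univ i))) i _ x (by simpa using hx)
        · rfl
      rcases Int.units_eq_one_or (Equiv.Perm.sign π) with h | h <;> simp [h, hzero]
    · simp
  have hdet : M.det ≠ 0 := fun h => hne (by rw [h, MvPolynomial.coeff_zero])
  obtain ⟨t, ht, hdt⟩ : ∃ t : V → ℝ, (∀ v, 0 < t v) ∧ MvPolynomial.eval t M.det ≠ 0 := by
    by_contra! h
    exact hdet (MvPolynomial.funext_set (fun _ => Set.Ioi (0 : ℝ)) (fun _ => Set.Ioi_infinite 0)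
      fun t ht => by simpa using h t fun v => ht v (Set.mem_univ v))
  refine ⟨t, ht, ?_⟩
  obtain ⟨D, hD, hDs⟩ := HasStrictFDerivAt.tupleSum c t
  refine hD.map_nhds_eq_of_surj ?_
  let A : Matrix ι ι ℝ := (MvPolynomial.eval t).mapMatrix M
  have hA : IsUnit A.det := by
    rw [← RingHom.map_det]
    exact hdt.isUnit
  have hAD : ∀ i j, A j i = D (Pi.single (p j) (t (p j))) i := by
    intro i j
    rw [hDs]
    simp [A, M, cnt, map_sum, map_prod]
  rw [LinearMap.range_eq_top]
  intro y
  refine ⟨∑ j, (Matrix.vecMul y A⁻¹) j • Pi.single (p j) (t (p j)), ?_⟩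
  have hy : Matrix.vecMul (Matrix.vecMul y A⁻¹) A = y := by
    rw [Matrix.vecMul_vecMul, Matrix.nonsing_inv_mul A hA, Matrix.vecMul_one]
  funext i
  conv_rhs => rw [← hy]
  simp only [ContinuousLinearMap.coe_coe, map_sum, map_smul, Finset.sum_apply, Pi.smul_apply,
    smul_eq_mul, ← hAD]
  rfl

end PolynomialMap

/-! ### Densities of Lyndon permutations -/

namespace Permutation

section BlockPoints

variable {B : Type*} [LinearOrder B] (letter : B → Permutation) [Fintype (BlockPoint letter)]

/-- The rank of a point by its first coordinate. -/
noncomputable def horizontalRank :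
    BlockPoint letter ≃ Fin (Fintype.card (BlockPoint letter)) :=
  (monoEquivOfFin (BlockPoint letter) rfl).symm.toEquiv

/-- The rank of a point by its second coordinate. -/
noncomputable def verticalRank :
    BlockPoint letter ≃ Fin (Fintype.card (BlockPoint letter)) :=
  (blockPerm letter).trans (horizontalRank letter)

theorem horizontalRank_lt_iff {v v' : BlockPoint letter} :
    horizontalRank letter v < horizontalRank letter v' ↔ v < v' :=
  (monoEquivOfFin (BlockPoint letter) rfl).symm.lt_iff_lt

theorem verticalRank_lt_iff {v v' : BlockPoint letter} :
    verticalRank letter v < verticalRank letter v' ↔ blockPerm letter v < blockPerm letter v' :=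
  horizontalRank_lt_iff letter

/-- The pattern induced by points in different unit squares is formed by the squares: up to the
order in which the squares are listed, they are an occurrence of it. -/
theorem exists_isPatternMap_of_blowupCoeff_ne_zero (a : Permutation)
    {f : Fin a.1 → BlockPoint letter} (hf : Function.Injective f)
    (h : blowupCoeff (horizontalRank letter) (verticalRank letter) a f ≠ 0) :
    ∃ τ : Equiv.Perm (Fin a.1), IsPatternMap letter a (f ∘ τ) := by
  obtain ⟨u, τ, hτ, hτ'⟩ := nonempty_of_measureReal_ne_zero h
  have key : ∀ (X : BlockPoint letter ≃ Fin (Fintype.card (BlockPoint letter))) (i j : Fin a.1),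
      ((X (f i) : ℕ) : ℝ) + u i < ((X (f j) : ℕ) : ℝ) + u j → X (f i) ≠ X (f j) →
      X (f i) < X (f j) := by
    intro X i j hlt hne
    have h1 : ((X (f i) : ℕ) : ℝ) < ((X (f j) : ℕ) : ℝ) + 1 := by
      linarith [(u i).2.1, (u j).2.2]
    exact lt_of_le_of_ne (Fin.le_def.2 (Nat.lt_succ_iff.1 (by exact_mod_cast h1))) hne
  refine ⟨τ, fun x y hxy => ?_, fun x y hxy => ?_⟩
  · refine (horizontalRank_lt_iff letter).1 (key _ _ _ (hτ hxy) fun h => ?_)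
    exact hxy.ne (τ.injective (hf ((horizontalRank letter).injective h)))
  · refine (verticalRank_lt_iff letter).1 (key _ _ _ ((hτ' x y).1 hxy) fun h => ?_)
    rw [τ.injective (hf ((verticalRank letter).injective h))] at hxy
    exact lt_irrefl _ hxy

/-- All points of the squares of an occurrence induce the pattern, apart from ties, which need
`u i = 1` for some `i`. -/
theorem IsPatternMap.blowupCoeff_ne_zero {letter : B → Permutation}
    [Fintype (BlockPoint letter)] {a : Permutation}
    {f : Fin a.1 → BlockPoint letter} (hf : IsPatternMap letter a f) :
    blowupCoeff (horizontalRank letter) (verticalRank letter) a f ≠ 0 := by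
  have hsub : Set.univ.pi (fun _ : Fin a.1 => Set.Iio (1 : unitInterval)) ⊆
      {u | a.PlaneInduced (fun i => ((horizontalRank letter (f i) : ℕ) : ℝ) + u i)
        (fun i => ((verticalRank letter (f i) : ℕ) : ℝ) + u i)} := by
    intro u hu
    have key : ∀ (i j : Fin a.1) (x y : Fin (Fintype.card (BlockPoint letter))), x < y →
        ((x : ℕ) : ℝ) + u i < ((y : ℕ) : ℝ) + u j := by
      intro i j x y h
      have h1 : ((x : ℕ) : ℝ) + 1 ≤ (y : ℕ) := by exact_mod_cast h
      have h2 : (u i : ℝ) < 1 := hu i (Set.mem_univ i)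
      linarith [(u j).2.1]
    have hy : ∀ i j, a.2 i < a.2 j → ((verticalRank letter (f i) : ℕ) : ℝ) + u i <
        ((verticalRank letter (f j) : ℕ) : ℝ) + u j :=
      fun i j h => key _ _ _ _ ((verticalRank_lt_iff letter).2 (hf.2 i j h))
    refine ⟨1, fun i j h => key _ _ _ _ ((horizontalRank_lt_iff letter).2 (hf.1 h)),
      fun i j => ⟨hy i j, fun h => ?_⟩⟩
    rcases lt_trichotomy (a.2 i) (a.2 j) with h' | h' | h'
    · exact h'
    · rw [a.2.injective h'] at h
      exact absurd h (lt_irrefl _)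
    · exact absurd h (lt_asymm (hy j i h'))
  have h1 : (volume : Measure (Fin a.1 → unitInterval)).real
      (Set.univ.pi (fun _ : Fin a.1 => Set.Iio (1 : unitInterval))) = 1 := by
    rw [measureReal_def, volume_pi, Measure.pi_pi]
    simp [unitInterval.volume_Iio]
  exact (lt_of_lt_of_le zero_lt_one (h1.symm.le.trans (measureReal_mono hsub))).ne'

end BlockPoints

/-- The canonical occurrence of the direct sum of the word `w i` in the direct sum of all words:
its image consists of all blocks that belong to `i`. -/
theorem exists_canonical_isPatternMap {ι : Type*} [LinearOrder ι] (w : ι → List Permutation)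
    (i : ι) : ∃ f : Fin (directSumList (w i)).1 → BlockPoint (wordLetter w),
      IsPatternMap (wordLetter w) _ f ∧ ∀ v, (∃ x, f x = v) ↔ (ofLex (ofLex v).1).1 = i := by
  obtain ⟨e, he1, he2, he3, he4⟩ := exists_directSumList_param (w i)
  let e' : (Σ s, Fin ((w i).get s).1) → Fin (directSumList (w i)).1 := fun q => e q.1 q.2
  have he' : Function.Bijective e' := by
    refine ⟨?_, fun x => ?_⟩
    · rintro ⟨s, b⟩ ⟨s', b'⟩ (h : e s b = e s' b')
      rcases lt_trichotomy s s' with hs | rfl | hs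
      · exact absurd h (he1 _ _ _ _ hs).ne
      · rw [(he2 s).injective h]
      · exact absurd h (he1 _ _ _ _ hs).ne'
    · obtain ⟨s, b, rfl⟩ := he3 x
      exact ⟨⟨s, b⟩, rfl⟩
  let E := Equiv.ofBijective e' he'
  let f : Fin (directSumList (w i)).1 → BlockPoint (wordLetter w) :=
    fun x => blockPoint (wordLetter w) (toLex ⟨i, (E.symm x).1⟩) (E.symm x).2
  have hf : ∀ s b, f (e s b) = blockPoint (wordLetter w) (toLex ⟨i, s⟩) b := by
    intro s b
    have h : E.symm (e s b) = ⟨s, b⟩ := E.symm_apply_apply ⟨s, b⟩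
    simp only [f]
    rw [h]
  have hmono : StrictMono f := by
    intro x y hxy
    obtain ⟨s, b, rfl⟩ := he3 x
    obtain ⟨s', b', rfl⟩ := he3 y
    rw [hf, hf]
    rcases lt_trichotomy s s' with hs | rfl | hs
    · exact blockPoint_lt_of_lt (wordBlock_strictMono i hs) _ _
    · exact blockPoint_strictMono _ ((he2 s).lt_iff_lt.1 hxy)
    · exact absurd hxy (lt_asymm (he1 _ _ _ _ hs))
  have hperm : ∀ x, blockPerm (wordLetter w) (f x) = f ((directSumList (w i)).2 x) := by
    intro x
    obtain ⟨s, b, rfl⟩ := he3 x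
    rw [he4, hf, hf]
    rfl
  refine ⟨f, ⟨hmono, fun x y hxy => ?_⟩, fun v => ⟨?_, ?_⟩⟩
  · rw [hperm, hperm]
    exact hmono hxy
  · rintro ⟨x, rfl⟩
    rfl
  · rintro rfl
    exact ⟨e _ _, hf (ofLex (ofLex v).1).2 (ofLex v).2⟩

/-- The polynomials that describe the densities of finitely many Lyndon permutations in the
blow-ups of their direct sum form a map that is open at some point with positive coordinates. -/
theorem exists_map_nhds_tupleSum_blowupCoeff {ι : Type} [Fintype ι] [Nonempty ι]
    (w : ι → List Permutation) (hinj : Function.Injective w)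
    (hind : ∀ i, ∀ b ∈ w i, Indecomposable b)
    (hlyn : ∀ i, IsLyndonWord LetterLT (w i)) :
    ∃ (V : Type) (_ : Fintype V) (_ : Nonempty V) (N : ℕ) (X Y : V ≃ Fin N) (t : V → ℝ),
      (∀ v, 0 < t v) ∧
      Filter.map (tupleSum fun i => blowupCoeff X Y (directSumList (w i))) (nhds t) =
        nhds (tupleSum (fun i => blowupCoeff X Y (directSumList (w i))) t) := by
  classical
  let _ : LinearOrder Permutation := letterOrder
  let _ : LinearOrder ι := LinearOrder.lift' (fun i => OrderDual.toDual (w i)) hinj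
  have hdec : ∀ i j : ι, i < j → List.Lex LetterLT (w j) (w i) := by
    intro i j hij
    rw [letterLT_eq]
    exact hij
  have : Fintype (BlockPoint (wordLetter w)) := inferInstanceAs (Fintype (Σ β, Fin _))
  choose f hf hfi using exists_canonical_isPatternMap w
  have hp : ∀ i, ∃ v : BlockPoint (wordLetter w), (ofLex (ofLex v).1).1 = i := by
    intro i
    have hs : 0 < (w i).length := List.length_pos_iff.2 (hlyn i).1
    have hb : 0 < ((w i).get ⟨0, hs⟩).1 := (hind i _ (List.get_mem _ _)).1
    exact ⟨blockPoint (wordLetter w) (toLex ⟨i, ⟨0, hs⟩⟩) ⟨0, hb⟩, rfl⟩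
  choose p hp using hp
  let c : (i : ι) → (Fin (directSumList (w i)).1 → BlockPoint (wordLetter w)) → ℝ :=
    fun i => blowupCoeff (horizontalRank (wordLetter w)) (verticalRank (wordLetter w)) _
  have huniq : ∀ F : (i : ι) → Fin (directSumList (w i)).1 → BlockPoint (wordLetter w),
      Function.Bijective (fun q : Σ i, Fin (directSumList (w i)).1 => F q.1 q.2) →
      (∀ i, c i (F i) ≠ 0) → ∀ i j x, F i x = p j → j = i := by
    intro F hF hF0 i j x hx
    have hFi : ∀ i, Function.Injective (F i) := fun i x y h =>
      eq_of_heq (Sigma.mk.inj (hF.1 (a₁ := ⟨i, x⟩) (a₂ := ⟨i, y⟩) h)).2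
    choose τ hτ using fun i =>
      exists_isPatternMap_of_blowupCoeff_ne_zero (wordLetter w) _ (hFi i) (hF0 i)
    have h := block_eq_of_isPatternMap w hind hlyn hdec (fun i => F i ∘ τ i) hτ ?_ i
      ((τ i).symm x)
    · rw [← hp j, ← hx]
      simpa using h
    · intro v
      obtain ⟨⟨i, x⟩, h⟩ := hF.2 v
      exact ⟨i, (τ i).symm x, by simpa using h⟩
  have hex : ∃ F : (i : ι) → Fin (directSumList (w i)).1 → BlockPoint (wordLetter w),
      Function.Bijective (fun q : Σ i, Fin (directSumList (w i)).1 => F q.1 q.2) ∧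
      (∀ i, c i (F i) ≠ 0) ∧ ∀ i, ∃ x, F i x = p i := by
    refine ⟨f, ⟨?_, ?_⟩, fun i => (hf i).blowupCoeff_ne_zero, fun i => (hfi i _).2 (hp i)⟩
    · rintro ⟨i, x⟩ ⟨j, y⟩ (h : f i x = f j y)
      obtain rfl : i = j := by
        rw [← (hfi i _).1 ⟨x, rfl⟩, ← (hfi j _).1 ⟨y, rfl⟩, h]
      rw [(hf i).1.injective h]
    · intro v
      obtain ⟨x, hx⟩ := (hfi _ v).2 rfl
      exact ⟨⟨_, x⟩, hx⟩
  obtain ⟨t, ht⟩ := exists_map_nhds_tupleSum_eq c (fun i f => blowupCoeff_nonneg _ _ _ f) p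
    huniq hex
  exact ⟨_, _, ⟨p (Classical.arbitrary ι)⟩, _, _, _, t, ht⟩

/-- The density polynomial of the permutation of size one is the total mass. -/
theorem sum_blowupCoeff_of_size_eq_one {V : Type*} [Fintype V] {N : ℕ} (X Y : V ≃ Fin N)
    {a : Permutation} (ha : a.1 = 1) (t : V → ℝ) [DecidableEq (Fin a.1)] :
    ∑ f : Fin a.1 → V, blowupCoeff X Y a f * ∏ x, t (f x) = ∑ v, t v := by
  obtain ⟨n, p⟩ := a
  simp only at ha
  subst ha
  have h1 : ∀ f, blowupCoeff X Y ⟨1, p⟩ f = 1 := by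
    intro f
    rw [blowupCoeff, Set.eq_univ_of_forall (s := {u | _}), probReal_univ]
    exact fun u => ⟨1, Subsingleton.strictMono _, fun i j => by simp [Subsingleton.elim i j]⟩
  simp only [h1, one_mul, Finset.univ_unique, Finset.prod_singleton]
  exact Fintype.sum_equiv (Equiv.funUnique (Fin 1) V) _ _ fun f => rfl

/-- The density of a permutation in a blow-up whose masses are normalized. -/
theorem exists_density_eq_div {V : Type*} [Fintype V] {N : ℕ} (X Y : V ≃ Fin N) {t : V → ℝ}
    (ht : ∀ v, 0 < t v) (hpos : 0 < ∑ v, t v) : ∃ P : Permuton, ∀ a : Permutation,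
      a.density P = (∑ f : Fin a.1 → V, blowupCoeff X Y a f * ∏ x, t (f x)) /
        (∑ v, t v) ^ a.1 := by
  have hsum : ∑ v, t v / (∑ v, t v) = 1 := by
    rw [← Finset.sum_div, div_self hpos.ne']
  refine ⟨blowup X Y (t := fun v => t v / ∑ v, t v) (fun v => div_pos (ht v) hpos) hsum,
    fun a => ?_⟩
  rw [density_blowup, Finset.sum_div]
  refine Finset.sum_congr rfl fun f _ => ?_
  rw [Finset.prod_div_distrib, Finset.prod_const, Finset.card_univ, Fintype.card_fin,
    mul_div_assoc]

theorem density_mem_Icc (a : Permutation) (P : Permuton) : a.density P ∈ Set.Icc (0 : ℝ) 1 := by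
  have := P.isProbabilityMeasure
  exact ⟨measureReal_nonneg, measureReal_le_one⟩

theorem indecomposable_of_size_eq_one {a : Permutation} (ha : a.size = 1) :
    a.Indecomposable := by
  refine ⟨ha.ge, ?_⟩
  rintro b c hb hc rfl
  simp only [size, directSum] at ha hb hc
  omega

end Permutation

open Permutation in
theorem theorem1p2 (k : ℕ) (hk : 2 ≤ k) :
    ∃ (x₀ : EuclideanSpace ℝ (Permutation.lyndonPermutations k)) (ε : ℝ),
      (∀ σ, x₀ σ ∈ Set.Icc (0 : ℝ) 1) ∧ 0 < ε ∧
      (∀ x ∈ Metric.ball x₀ ε, ∀ σ, x σ ∈ Set.Icc (0 : ℝ) 1) ∧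
      ∀ x ∈ Metric.ball x₀ ε, ∃ P : Permuton,
        ∀ σ : Permutation.lyndonPermutations k, Permutation.density σ.1 P = x σ := by
  classical
  have hmem : ∀ σ : lyndonPermutations k, 2 ≤ σ.1.size ∧ IsLyndon σ.1 := by
    intro σ
    have := σ.2
    simp only [lyndonPermutations, Finset.mem_filter, Finset.mem_sigma, Finset.mem_Icc] at this
    exact ⟨this.1.1.1, this.2⟩
  choose w₀ hw₀ hlyn₀ using fun σ => (hmem σ).2
  -- the permutation of size one is added to keep track of the total mass
  let one : Permutation := ⟨1, Equiv.refl _⟩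
  let w : Option (lyndonPermutations k) → List Permutation := fun i => i.elim [one] w₀
  have hone : (directSumList (w none)).1 = 1 := rfl
  have hsome : ∀ σ, directSumList (w (some σ)) = σ.1 := fun σ => (hw₀ σ).2
  have hne : ∀ σ, w none ≠ w (some σ) := by
    intro σ h
    have h1 : 2 ≤ (directSumList (w (some σ))).1 := (hsome σ).symm ▸ (hmem σ).1
    rw [← h, hone] at h1
    omega
  have hinj : Function.Injective w := by
    rintro (_ | σ) (_ | σ') h
    · rfl
    · exact absurd h (hne σ')
    · exact absurd h.symm (hne σ)
    · rw [Subtype.ext ((hsome σ).symm.trans ((congrArg directSumList h).trans (hsome σ')))]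
  have hind : ∀ i, ∀ b ∈ w i, Indecomposable b := by
    rintro (_ | σ) b hb
    · obtain rfl : b = one := by simpa [w] using hb
      exact indecomposable_of_size_eq_one rfl
    · exact (hw₀ σ).1 b hb
  have hlyn : ∀ i, IsLyndonWord LetterLT (w i) := by
    rintro (_ | σ)
    · refine ⟨by simp [w], fun u v hu hv h => ?_⟩
      have := congrArg List.length h
      have h1 := List.length_pos_iff.2 hu
      have h2 := List.length_pos_iff.2 hv
      simp [w] at this
      omega
    · exact hlyn₀ σ
  obtain ⟨V, _, _, N, X, Y, t₀, ht₀, hopen⟩ :=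
    exists_map_nhds_tupleSum_blowupCoeff w hinj hind hlyn
  let G := tupleSum fun i => blowupCoeff X Y (directSumList (w i))
  have hG : ∀ t, G t none = ∑ v, t v := fun t => sum_blowupCoeff_of_size_eq_one X Y hone t
  let ψ : EuclideanSpace ℝ (lyndonPermutations k) → Option (lyndonPermutations k) → ℝ :=
    fun x i => i.elim (G t₀ none) (fun σ => x σ * G t₀ none ^ σ.1.1)
  have hpos : ∀ t : V → ℝ, (∀ v, 0 < t v) → 0 < ∑ v, t v :=
    fun t ht => Finset.sum_pos (fun v _ => ht v) Finset.univ_nonempty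
  have hT := hpos t₀ ht₀
  have hdens : ∀ t : V → ℝ, (∀ v, 0 < t v) → ∃ P : Permuton, ∀ σ : lyndonPermutations k,
      σ.1.density P = G t (some σ) / G t none ^ σ.1.1 := by
    intro t ht
    obtain ⟨P, hP⟩ := exists_density_eq_div X Y ht (hpos t ht)
    refine ⟨P, fun σ => ?_⟩
    rw [← hsome σ, hP, hG]
    rfl
  let x₀ : EuclideanSpace ℝ (lyndonPermutations k) :=
    WithLp.toLp 2 fun σ => G t₀ (some σ) / G t₀ none ^ σ.1.1
  have hψ₀ : ψ x₀ = G t₀ := by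
    funext i
    rcases i with _ | σ
    · rfl
    · exact div_mul_cancel₀ _ (pow_ne_zero _ ((hG t₀).symm ▸ hT.ne'))
  have hψ : Continuous ψ := by
    refine continuous_pi fun i => ?_
    rcases i with _ | σ
    · exact continuous_const
    · simp only [ψ, Option.elim]
      fun_prop
  have hU : {t : V → ℝ | ∀ v, 0 < t v} ∈ nhds t₀ := by
    have := set_pi_mem_nhds (Set.finite_univ (α := V)) fun v _ => Ioi_mem_nhds (ht₀ v)
    exact Filter.mem_of_superset this fun t ht v => ht v (Set.mem_univ v)
  have hnhds : ψ ⁻¹' (G '' {t | ∀ v, 0 < t v}) ∈ nhds x₀ := by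
    refine hψ.continuousAt ?_
    rw [hψ₀]
    exact hopen ▸ Filter.image_mem_map hU
  obtain ⟨ε, hε, hball⟩ := Metric.mem_nhds_iff.1 hnhds
  have hmain : ∀ x ∈ Metric.ball x₀ ε, ∃ P : Permuton,
      ∀ σ : lyndonPermutations k, σ.1.density P = x σ := by
    intro x hx
    obtain ⟨t, ht, hGt⟩ := hball hx
    obtain ⟨P, hP⟩ := hdens t ht
    refine ⟨P, fun σ => ?_⟩
    rw [hP, hGt]
    exact mul_div_cancel_right₀ _ (pow_ne_zero _ ((hG t₀).symm ▸ hT.ne'))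
  have hIcc : ∀ x ∈ Metric.ball x₀ ε, ∀ σ, x σ ∈ Set.Icc (0 : ℝ) 1 := by
    intro x hx σ
    obtain ⟨P, hP⟩ := hmain x hx
    exact hP σ ▸ density_mem_Icc σ.1 P
  exact ⟨x₀, ε, hIcc x₀ (Metric.mem_ball_self hε), hε, hIcc, hmain⟩
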